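/- All C*-algebras are unital and $\otimes$ is the completed spatial (minimal) tensor product. Let $X$ be a set and $\mathcal A_X=\{A_x\}_{x\in X}$ a family of C*-algebras. An *operator field* on $\mathcal A_X$ is a map $f$ with $f(x)\in A_x$ for all $x\in X$; it is *scalar valued* if $f=\tilde c$ for some $c:X\to\mathbb C$, where $\tilde c(x):=c(x)1_x$. A *metric operator field* (mof) on $\mathcal A_X$ is a family $D=(D_{x,x'})_{x,x'\in X}$, $D_{x,x'}\in A_x\otimes A_{x'}$, such that: (i) there are states $\mu_x$ of $A_x$ ($x\in X$) with $(\mu_x\otimes\mu_x)D_{x,x}=0$ for all $x$; (ii) $D_{x,x'}$ is positive and invertible for $x\ne x'$; (iii) $D_{x,x'}$ is the flip of $D_{x',x}$; (iv) $\mathfrak M D_{x,x''}\le D_{x,x'}\otimes 1_{x''}+1_x\otimes D_{x',x''}$ in $A_x\otimes A_{x'}\otimes A_{x''}$ for all $x,x',x''$, where $\mathfrak M(a\otimes c)=a\otimes 1_{x'}\otimes c$. The mof $D$ is *central* if $D_{x,x'}\in\mathcal Z(A_x)\otimes\mathcal Z(A_{x'})$ for all $x,x'$, where $\mathcal Z$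 denotes the center; *scalar valued* if there is an ordinary metric $d$ on $X$ with $D_{x,x'}=d(x,x')\,1_x\otimes 1_{x'}$ for all $x,x'$; and *bounded* if $\sup_{x,x'}\|D_{x,x'}\|<\infty$. An operator field $f$ is *Lipschitz* with respect to $D$ if $$\|f\|_D:=\sup_{x\ne x'}\big\|D_{x,x'}^{-1/2}\,(f(x)\otimes 1_{x'}-1_x\otimes f(x'))\,D_{x,x'}^{-1/2}\big\|<\infty .$$ $\mathbf{Lip}(D)$ is the set of bounded Lipschitz operator fields $f$ such that $D_{x,x'}$ commutes with $f(x)\otimes 1_{x'}$ for all $x,x'$. Let $D^{\|\cdot\|}$ be the metric on $X$ given by $D^{\|\cdot\|}(x,x')=\|D_{x,x'}\|$ for $x\neq x'$ and $D^{\|\cdot\|}(x,x)=0$, and let $\mathbf{Lip}(D^{\|\cdot\|})$ be the set of bounded functions $X\to\mathbb C$ that are Lipschitz for this metric. **Theorem.** Let $D$ be a central mof on $\mathcal A_X$ which is not scalar valued. Then there exists a Lipschitz operator field on $\mathcal A_X$ which is not scalar valued; more precisely, there are $x_0\in X$ and a state $\mu$ of $A_{x_0}$ such that the operator field $x\mapsto(\mu\otimes\mathrm{id})D_{x_0,x}$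 is Lipschitz and not scalar valued. Moreover, if $D$ is bounded, then the assignment $f\mapsto\tilde f$ $(f\in\mathbf{Lip}(D^{\|\cdot\|}))$ does not reach all of $\mathbf{Lip}(D)$: there is $g\in\mathbf{Lip}(D)$ such that $g\ne\tilde f$ for every $f\in\mathbf{Lip}(D^{\|\cdot\|})$. In particular, whenever $f\mapsto\tilde f$ maps $\mathbf{Lip}(D^{\|\cdot\|})$ into $\mathbf{Lip}(D)$, this map is not surjective. -/

import Mathlib

open scoped TensorProduct ENNReal

universe u v

noncomputable section

/-- A (unital) `*`-representation of a unital C*-algebra on a Hilbert space. -/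
structure HilbertRep (A : Type v) [CStarAlgebra A] where
  space : Type v
  [normedGroup : NormedAddCommGroup space]
  [innerProduct : InnerProductSpace ℂ space]
  [complete : CompleteSpace space]
  hom : A →⋆ₐ[ℂ] (space →L[ℂ] space)

attribute [instance] HilbertRep.normedGroup HilbertRep.innerProduct HilbertRep.complete

/-- The pullback of a representation along a unital `*`-homomorphism. -/
def HilbertRep.comap {A B : Type v} [CStarAlgebra A] [CStarAlgebra B] (π : HilbertRep B)
    (α : A →⋆ₐ[ℂ] B) : HilbertRep A where
  space := π.space
  hom := π.hom.comp α

/-- A state of a unital C*-algebra: a positive linear functional with `φ 1 = 1`. -/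
structure CState (A : Type v) [CStarAlgebra A] where
  functional : A →L[ℂ] ℂ
  apply_one : functional 1 = 1
  re_nonneg : ∀ a : A, 0 ≤ (functional (star a * a)).re
  im_eq_zero : ∀ a : A, (functional (star a * a)).im = 0

section States

variable {A : Type v} [CStarAlgebra A]

theorem im_eq_zero_of_contractive (g : A →L[ℂ] ℂ) (h1 : g 1 = 1) (hg : ∀ a, ‖g a‖ ≤ ‖a‖)
    (h : A) (hh : IsSelfAdjoint h) : (g h).im = 0 := by
  have key : ∀ t : ℝ, (g h).im ^ 2 + 2 * t * (g h).im + t ^ 2 ≤ ‖h‖ ^ 2 + t ^ 2 := by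
    intro t
    set c : A := h + ((t : ℂ) * Complex.I) • (1 : A) with hc
    have e1 : star c * c = h * h + ((t : ℂ) ^ 2) • (1 : A) := by
      rw [hc, star_add, star_smul, hh.star_eq, star_one]
      simp only [star_mul', Complex.star_def, Complex.conj_I, Complex.conj_ofReal, add_mul,
        mul_add, smul_mul_assoc, mul_smul_comm, one_mul, mul_one, smul_add, smul_smul]
      have : (t : ℂ) * Complex.I * (t * -Complex.I) = (t : ℂ) ^ 2 := by
        linear_combination (-(t : ℂ) ^ 2) * Complex.I_mul_I
      rw [this, mul_neg, neg_smul]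
      abel
    have e2 : ‖c‖ ^ 2 ≤ ‖h‖ ^ 2 + t ^ 2 := by
      have hone : ‖(1 : A)‖ ≤ 1 := by
        rcases subsingleton_or_nontrivial A with hs | hn
        · rw [Subsingleton.elim (1 : A) 0, norm_zero]; exact zero_le_one
        · exact CStarRing.norm_one.le
      calc ‖c‖ ^ 2 = ‖star c * c‖ := by rw [CStarRing.norm_star_mul_self, sq]
        _ ≤ ‖h * h‖ + ‖((t : ℂ) ^ 2) • (1 : A)‖ := by rw [e1]; exact norm_add_le _ _
        _ ≤ ‖h‖ ^ 2 + t ^ 2 := by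
          refine add_le_add ((norm_mul_le _ _).trans_eq (sq _).symm) ?_
          rw [norm_smul]
          have : ‖((t : ℂ) ^ 2)‖ = t ^ 2 := by simp
          rw [this]
          nlinarith [sq_nonneg t]
    have e3 : g c = g h + t * Complex.I := by rw [hc, map_add, map_smul, h1]; simp
    have e4 : ‖g c‖ ^ 2 = (g h).re ^ 2 + ((g h).im + t) ^ 2 := by
      rw [e3, ← Complex.normSq_eq_norm_sq, Complex.normSq_apply]
      simp
      ring
    have e5 : ‖g c‖ ^ 2 ≤ ‖c‖ ^ 2 := by gcongr; exact hg c
    nlinarith [sq_nonneg (g h).re]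
  by_contra hne
  have := key ((‖h‖ ^ 2) / (g h).im)
  have h2 : 2 * (‖h‖ ^ 2 / (g h).im) * (g h).im = 2 * ‖h‖ ^ 2 := by field_simp
  have h3 : 0 < (g h).im ^ 2 := by positivity
  nlinarith [sq_nonneg ‖h‖]

theorem re_nonneg_of_contractive [PartialOrder A] [StarOrderedRing A] (g : A →L[ℂ] ℂ)
    (h1 : g 1 = 1) (hg : ∀ a, ‖g a‖ ≤ ‖a‖) (h : A) (hh : 0 ≤ h) : 0 ≤ (g h).re := by
  have hsa : IsSelfAdjoint h := IsSelfAdjoint.of_nonneg hh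
  have hle : h ≤ algebraMap ℝ A ‖h‖ := hsa.le_algebraMap_norm_self
  have h2 : ‖algebraMap ℝ A ‖h‖ - h‖ ≤ ‖h‖ := by
    rw [CStarAlgebra.norm_le_iff_le_algebraMap _ (norm_nonneg h) (sub_nonneg.2 hle)]
    exact sub_le_self _ hh
  have h3 : g (algebraMap ℝ A ‖h‖ - h) = ‖h‖ - g h := by
    have : algebraMap ℝ A ‖h‖ = (‖h‖ : ℂ) • (1 : A) := by
      rw [Algebra.algebraMap_eq_smul_one]
      exact (Complex.coe_smul _ _).symm
    rw [map_sub, this, map_smul, h1]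
    simp
  have h4 := (hg _).trans h2
  rw [h3] at h4
  have h5 := (Complex.re_le_norm ((‖h‖ : ℂ) - g h)).trans h4
  simp at h5
  linarith

/-- Every element of a nonzero unital C*-algebra has its norm witnessed by a state. -/
theorem exists_state_norm [Nontrivial A] (b : A) :
    ∃ φ : CState A, φ.functional (star b * b) = (‖b‖ : ℂ) ^ 2 := by
  let _ := CStarAlgebra.spectralOrder A
  have _ := CStarAlgebra.spectralOrderedRing A
  set a : A := star b * b with ha
  have ha0 : 0 ≤ a := star_mul_self_nonneg b
  have hspec : ‖a‖ ∈ spectrum ℝ a := CStarAlgebra.norm_mem_spectrum_of_nonneg ha0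
  have hnorm : 1 + ‖a‖ ≤ ‖1 + a‖ := by
    have : 1 + ‖a‖ ∈ spectrum ℝ (1 + a) := by
      have := spectrum.add_mem_add_iff (R := ℝ) (a := a) (r := ‖a‖) (s := 1)
      simpa [add_comm] using this.2 hspec
    have h2 := spectrum.norm_le_norm_of_mem this
    exact (le_abs_self _).trans h2
  have hnorm' : ‖1 + a‖ = 1 + ‖a‖ :=
    le_antisymm ((norm_add_le _ _).trans_eq (by rw [CStarRing.norm_one])) hnorm
  obtain ⟨g, hg1, hg2⟩ := exists_dual_vector' ℂ (1 + a)
  have hg : ∀ c, ‖g c‖ ≤ ‖c‖ := fun c => by simpa [hg1] using g.le_opNorm c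
  have hsum : g 1 + g a = 1 + ‖a‖ := by
    rw [← map_add, hg2, hnorm']; simp
  have r1 : (g 1).re ≤ 1 := by
    have := (Complex.re_le_norm _).trans (hg 1)
    rwa [CStarRing.norm_one] at this
  have r2 : (g a).re ≤ ‖a‖ := (Complex.re_le_norm _).trans (hg a)
  have hre : (g 1).re + (g a).re = 1 + ‖a‖ := by simpa using congrArg Complex.re hsum
  have r3 : (g 1).re = 1 := by linarith
  have r5 : (g 1).im = 0 := by
    have h6 : ‖g 1‖ ≤ 1 := by simpa [CStarRing.norm_one] using hg 1
    have h7 : ‖g 1‖ ^ 2 = (g 1).re ^ 2 + (g 1).im ^ 2 := by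
      rw [← Complex.normSq_eq_norm_sq, Complex.normSq_apply]; ring
    have h8 : ‖g 1‖ ^ 2 ≤ 1 := pow_le_one₀ (norm_nonneg _) h6
    rw [h7, r3] at h8
    have : (g 1).im ^ 2 = 0 := le_antisymm (by linarith) (sq_nonneg _)
    exact pow_eq_zero_iff two_ne_zero |>.1 this
  have g1 : g 1 = 1 := Complex.ext (by simpa using r3) (by simpa using r5)
  refine ⟨⟨g, g1, fun c => re_nonneg_of_contractive g g1 hg _ (star_mul_self_nonneg c),
    fun c => im_eq_zero_of_contractive g g1 hg _ (IsSelfAdjoint.star_mul_self c)⟩, ?_⟩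
  change g a = _
  have : g a = (‖a‖ : ℂ) := by
    rw [g1] at hsum
    exact add_left_cancel hsum
  rw [this, ha, CStarRing.norm_star_mul_self]
  push_cast
  ring

open scoped ComplexOrder in
/-- The GNS representation of a state, with its cyclic vector. -/
theorem CState.exists_rep (φ : CState A) :
    ∃ (π : HilbertRep A) (ξ : π.space), ∀ a, inner ℂ ξ (π.hom a ξ) = φ.functional a := by
  let _ := CStarAlgebra.spectralOrder A
  have _ := CStarAlgebra.spectralOrderedRing A
  have hpos : ∀ x : A, 0 ≤ x → 0 ≤ (φ.functional : A →ₗ[ℂ] ℂ) x := by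
    intro x hx
    obtain ⟨c, rfl⟩ := CStarAlgebra.nonneg_iff_eq_star_mul_self.1 hx
    exact Complex.nonneg_iff.2 ⟨φ.re_nonneg c, (φ.im_eq_zero c).symm⟩
  let f : A →ₚ[ℂ] ℂ := PositiveLinearMap.mk₀ (φ.functional : A →ₗ[ℂ] ℂ) hpos
  refine ⟨{ space := f.GNS, hom := f.gnsStarAlgHom },
    ((f.toPreGNS 1 : f.PreGNS) : UniformSpace.Completion f.PreGNS), fun a => ?_⟩
  change inner ℂ ((f.toPreGNS 1 : f.PreGNS) : f.GNS)
    (f.gnsNonUnitalStarAlgHom a ((f.toPreGNS 1 : f.PreGNS) : f.GNS)) = _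
  rw [PositiveLinearMap.gnsNonUnitalStarAlgHom_apply_coe, UniformSpace.Completion.inner_coe,
    PositiveLinearMap.preGNS_inner_def]
  simp
  rfl

theorem CState.norm_vector {φ : CState A} {π : HilbertRep A} {ξ : π.space}
    (h : ∀ a, inner ℂ ξ (π.hom a ξ) = φ.functional a) : ‖ξ‖ = 1 := by
  have h1 := h 1
  rw [map_one] at h1
  have h2 : inner ℂ ξ ξ = (1 : ℂ) := h1.trans φ.apply_one
  have h3 : ‖ξ‖ ^ 2 = 1 := by
    rw [← inner_self_eq_norm_sq (𝕜 := ℂ), h2]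
    simp
  exact (pow_eq_one_iff_of_nonneg (norm_nonneg _) two_ne_zero).1 h3

/-- The representation on the zero Hilbert space. -/
def zeroRep (A : Type v) [CStarAlgebra A] : HilbertRep A where
  space := PUnit
  hom :=
    { toFun := fun _ => 0
      map_one' := Subsingleton.elim _ _
      map_mul' := fun _ _ => Subsingleton.elim _ _
      map_zero' := Subsingleton.elim _ _
      map_add' := fun _ _ => Subsingleton.elim _ _
      commutes' := fun _ => Subsingleton.elim _ _
      map_star' := fun _ => Subsingleton.elim _ _ }

theorem exists_rep_norm (b : A) : ∃ ρ : HilbertRep A, ‖b‖ ≤ ‖ρ.hom b‖ := by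
  rcases subsingleton_or_nontrivial A with hs | hn
  · refine ⟨zeroRep A, ?_⟩
    rw [Subsingleton.elim b 0, norm_zero]
    exact norm_nonneg _
  · obtain ⟨φ, hφ⟩ := exists_state_norm b
    obtain ⟨ρ, ξ, h⟩ := φ.exists_rep
    refine ⟨ρ, ?_⟩
    have hξ := CState.norm_vector h
    have h2 := h (star b * b)
    rw [map_mul, map_star, mul_apply_eq_comp, ContinuousLinearMap.star_eq_adjoint,
      ContinuousLinearMap.adjoint_inner_right, hφ] at h2
    have h3 : ‖ρ.hom b ξ‖ ^ 2 = ‖b‖ ^ 2 := by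
      rw [← inner_self_eq_norm_sq (𝕜 := ℂ), h2, ← Complex.ofReal_pow]
      exact Complex.ofReal_re _
    have h4 : ‖ρ.hom b ξ‖ = ‖b‖ :=
      (pow_left_inj₀ (norm_nonneg _) (norm_nonneg _) two_ne_zero).1 h3
    rw [← h4]
    simpa [hξ] using (ρ.hom b).le_opNorm ξ

end States

/-- The algebraic tensor product `A ⊙ B` over `ℂ`, as a type of its own carrying the spatial
seminorm. -/
def AlgTensor (A B : Type v) [CStarAlgebra A] [CStarAlgebra B] : Type v := A ⊗[ℂ] B

section Algebraic

variable {A B C : Type v} [CStarAlgebra A] [CStarAlgebra B] [CStarAlgebra C]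

instance : Ring (AlgTensor A B) := inferInstanceAs (Ring (A ⊗[ℂ] B))
instance : Algebra ℂ (AlgTensor A B) := inferInstanceAs (Algebra ℂ (A ⊗[ℂ] B))
instance : StarAddMonoid (AlgTensor A B) := inferInstanceAs (StarAddMonoid (A ⊗[ℂ] B))
instance : StarModule ℂ (AlgTensor A B) := inferInstanceAs (StarModule ℂ (A ⊗[ℂ] B))

/-- The elementary tensor `a ⊗ b` in `A ⊙ B`. -/
def AlgTensor.mk (a : A) (b : B) : AlgTensor A B := (a ⊗ₜ[ℂ] b : A ⊗[ℂ] B)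

theorem AlgTensor.star_mk (a : A) (b : B) :
    star (AlgTensor.mk a b) = AlgTensor.mk (star a) (star b) := rfl

theorem AlgTensor.mk_mul_mk (a a' : A) (b b' : B) :
    AlgTensor.mk a b * AlgTensor.mk a' b' = AlgTensor.mk (a * a') (b * b') :=
  Algebra.TensorProduct.tmul_mul_tmul a a' b b'

theorem AlgTensor.one_def : (1 : AlgTensor A B) = AlgTensor.mk 1 1 := rfl

theorem AlgTensor.induction {p : AlgTensor A B → Prop} (zero : p 0)
    (mk : ∀ a b, p (AlgTensor.mk a b)) (add : ∀ s t, p s → p t → p (s + t))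
    (t : AlgTensor A B) : p t :=
  TensorProduct.induction_on (motive := p) t zero mk add

instance : StarRing (AlgTensor A B) where
  star_add := star_add
  star_mul s t := by
    induction s using AlgTensor.induction with
    | zero => simp
    | add s s' h h' => simp [add_mul, mul_add, h, h']
    | mk a b =>
      induction t using AlgTensor.induction with
      | zero => simp
      | add s s' h h' => simp [add_mul, mul_add, h, h']
      | mk a' b' => simp [AlgTensor.star_mk, AlgTensor.mk_mul_mk]

/-- The linear map `a ⊗ b ↦ π a ⊗ ρ b` underlying the representation `π ⊗ ρ`. -/
def tensorRepLin (π : HilbertRep A) (ρ : HilbertRep B) :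
    AlgTensor A B →ₗ[ℂ] (π.space ⊗[ℂ] ρ.space →L[ℂ] π.space ⊗[ℂ] ρ.space) :=
  TensorProduct.lift (LinearMap.mk₂ ℂ (fun a b => TensorProduct.mapL (π.hom a) (ρ.hom b))
    (fun a a' b => by rw [map_add, TensorProduct.mapL_add_left])
    (fun c a b => by rw [map_smul, TensorProduct.mapL_smul_left])
    (fun a b b' => by rw [map_add, TensorProduct.mapL_add_right])
    (fun c a b => by rw [map_smul, TensorProduct.mapL_smul_right]))

theorem tensorRepLin_mk (π : HilbertRep A) (ρ : HilbertRep B) (a : A) (b : B) :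
    tensorRepLin π ρ (AlgTensor.mk a b) = TensorProduct.mapL (π.hom a) (ρ.hom b) :=
  TensorProduct.lift.tmul a b

/-- The representation `π ⊗ ρ` of `A ⊙ B` on the algebraic tensor product of the two Hilbert
spaces with its inner product `⟪x ⊗ y, x' ⊗ y'⟫ = ⟪x, x'⟫ ⟪y, y'⟫`: it sends `a ⊗ b` to
`π a ⊗ ρ b`.  (Passing to the completed Hilbert space does not change operator norms.) -/
def tensorRep (π : HilbertRep A) (ρ : HilbertRep B) :
    AlgTensor A B →ₐ[ℂ] (π.space ⊗[ℂ] ρ.space →L[ℂ] π.space ⊗[ℂ] ρ.space) :=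
  AlgHom.ofLinearMap (tensorRepLin π ρ)
    (by
      rw [AlgTensor.one_def, tensorRepLin_mk, map_one, map_one]
      exact TensorProduct.mapL_id_id)
    (fun s t => by
      induction s using AlgTensor.induction with
      | zero => simp
      | add s s' h h' => rw [add_mul, map_add, map_add, add_mul, h, h']
      | mk a b =>
        induction t using AlgTensor.induction with
        | zero => simp
        | add t t' h h' => rw [mul_add, map_add, map_add, mul_add, h, h']
        | mk a' b' =>
          rw [AlgTensor.mk_mul_mk, tensorRepLin_mk, tensorRepLin_mk, tensorRepLin_mk,
            map_mul, map_mul, TensorProduct.mapL_mul])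

theorem tensorRep_mk (π : HilbertRep A) (ρ : HilbertRep B) (a : A) (b : B) :
    tensorRep π ρ (AlgTensor.mk a b) = TensorProduct.mapL (π.hom a) (ρ.hom b) :=
  tensorRepLin_mk π ρ a b

theorem tensorRep_mk_tmul (π : HilbertRep A) (ρ : HilbertRep B) (a : A) (b : B)
    (x : π.space) (y : ρ.space) :
    tensorRep π ρ (AlgTensor.mk a b) (x ⊗ₜ y) = π.hom a x ⊗ₜ ρ.hom b y := by
  rw [tensorRep_mk, TensorProduct.mapL_tmul]

theorem norm_inner_self_complex {E : Type*} [NormedAddCommGroup E] [InnerProductSpace ℂ E]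
    (x : E) : ‖inner ℂ x x‖ = ‖x‖ * ‖x‖ := by
  rw [inner_self_eq_norm_sq_to_K]
  simp [sq]

theorem inner_tensorRep_star (π : HilbertRep A) (ρ : HilbertRep B) (t : AlgTensor A B)
    (ξ η : π.space ⊗[ℂ] ρ.space) :
    inner ℂ (tensorRep π ρ (star t) ξ) η = inner ℂ ξ (tensorRep π ρ t η) := by
  induction t using AlgTensor.induction with
  | zero => simp
  | add s s' h h' => simp [inner_add_left, inner_add_right, h, h']
  | mk a b =>
    induction ξ using TensorProduct.induction_on with
    | zero => simp
    | add s s' h h' => simp only [inner_add_left, map_add, h, h']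
    | tmul x y =>
      induction η using TensorProduct.induction_on with
      | zero => simp
      | add s s' h h' => simp only [inner_add_right, map_add, h, h']
      | tmul x' y' =>
        rw [AlgTensor.star_mk, tensorRep_mk_tmul, tensorRep_mk_tmul, map_star, map_star,
          ContinuousLinearMap.star_eq_adjoint, ContinuousLinearMap.star_eq_adjoint]
        simp [ContinuousLinearMap.adjoint_inner_left]

theorem norm_tensorRep_mk_le (π : HilbertRep A) (ρ : HilbertRep B) (a : A) (b : B) :
    ‖tensorRep π ρ (AlgTensor.mk a b)‖ ≤ ‖a‖ * ‖b‖ := by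
  rw [tensorRep_mk]
  exact (TensorProduct.norm_mapL_le _ _).trans
    (mul_le_mul (NonUnitalStarAlgHom.norm_apply_le _ _) (NonUnitalStarAlgHom.norm_apply_le _ _)
      (norm_nonneg _) (norm_nonneg _))

/-- The spatial (minimal) norm of `t ∈ A ⊙ B`: the supremum of `‖(π ⊗ ρ) t‖` over all
representations `π` of `A` and `ρ` of `B`. -/
def spatialNorm (t : AlgTensor A B) : ℝ :=
  ⨆ p : HilbertRep A × HilbertRep B, ‖tensorRep p.1 p.2 t‖

theorem bddAbove_tensorRep (t : AlgTensor A B) :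
    BddAbove (Set.range fun p : HilbertRep A × HilbertRep B => ‖tensorRep p.1 p.2 t‖) := by
  suffices h : ∃ c : ℝ, ∀ (π : HilbertRep A) (ρ : HilbertRep B), ‖tensorRep π ρ t‖ ≤ c by
    obtain ⟨c, hc⟩ := h
    exact ⟨c, by rintro _ ⟨p, rfl⟩; exact hc p.1 p.2⟩
  induction t using AlgTensor.induction with
  | zero => exact ⟨0, fun π ρ => by rw [map_zero, ContinuousLinearMap.opNorm_zero]⟩
  | mk a b => exact ⟨_, fun π ρ => norm_tensorRep_mk_le π ρ a b⟩
  | add s t hs ht =>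
    obtain ⟨c, hc⟩ := hs
    obtain ⟨d, hd⟩ := ht
    refine ⟨c + d, fun π ρ => ?_⟩
    rw [map_add]
    exact (ContinuousLinearMap.opNorm_add_le _ _).trans (add_le_add (hc π ρ) (hd π ρ))

theorem norm_tensorRep_le (π : HilbertRep A) (ρ : HilbertRep B) (t : AlgTensor A B) :
    ‖tensorRep π ρ t‖ ≤ spatialNorm t :=
  le_ciSup (bddAbove_tensorRep t) (π, ρ)

theorem spatialNorm_nonneg (t : AlgTensor A B) : 0 ≤ spatialNorm t :=
  Real.iSup_nonneg fun _ => ContinuousLinearMap.opNorm_nonneg _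

theorem spatialNorm_le {t : AlgTensor A B} {c : ℝ} (hc : 0 ≤ c)
    (h : ∀ (π : HilbertRep A) (ρ : HilbertRep B), ‖tensorRep π ρ t‖ ≤ c) : spatialNorm t ≤ c :=
  Real.iSup_le (fun p => h p.1 p.2) hc

theorem norm_tensorRep_star_le (π : HilbertRep A) (ρ : HilbertRep B) (t : AlgTensor A B) :
    ‖tensorRep π ρ (star t)‖ ≤ ‖tensorRep π ρ t‖ := by
  refine ContinuousLinearMap.opNorm_le_bound _ (ContinuousLinearMap.opNorm_nonneg _) fun ξ => ?_
  set η := tensorRep π ρ (star t) ξ with hη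
  have h0' := ContinuousLinearMap.opNorm_nonneg (tensorRep π ρ t)
  have h1 : ‖η‖ * ‖η‖ ≤ ‖tensorRep π ρ t‖ * ‖ξ‖ * ‖η‖ := by
    calc ‖η‖ * ‖η‖ = ‖inner ℂ η η‖ := by
          exact (norm_inner_self_complex η).symm
      _ = ‖inner ℂ ξ (tensorRep π ρ t η)‖ := by
          conv_lhs => rw [hη]
          rw [inner_tensorRep_star]
      _ ≤ ‖ξ‖ * (‖tensorRep π ρ t‖ * ‖η‖) :=
          (norm_inner_le_norm _ _).trans
            (mul_le_mul_of_nonneg_left (ContinuousLinearMap.le_opNorm _ _) (norm_nonneg _))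
      _ = ‖tensorRep π ρ t‖ * ‖ξ‖ * ‖η‖ := by ring
  rcases (norm_nonneg η).eq_or_lt with h0 | h0
  · rw [← h0]; positivity
  · exact le_of_mul_le_mul_right h1 h0

theorem norm_tensorRep_sq_le (π : HilbertRep A) (ρ : HilbertRep B) (t : AlgTensor A B) :
    ‖tensorRep π ρ t‖ ^ 2 ≤ ‖tensorRep π ρ (star t * t)‖ := by
  have h0 := ContinuousLinearMap.opNorm_nonneg (tensorRep π ρ (star t * t))
  have h0' := ContinuousLinearMap.opNorm_nonneg (tensorRep π ρ t)
  have h : ‖tensorRep π ρ t‖ ≤ Real.sqrt ‖tensorRep π ρ (star t * t)‖ := by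
    refine ContinuousLinearMap.opNorm_le_bound _ (Real.sqrt_nonneg _) fun ξ => ?_
    refine abs_le_of_sq_le_sq' ?_ (by positivity) |>.2
    rw [mul_pow, Real.sq_sqrt h0]
    have e : inner ℂ (tensorRep π ρ (star t * t) ξ) ξ
        = inner ℂ (tensorRep π ρ t ξ) (tensorRep π ρ t ξ) := by
      rw [map_mul, mul_apply_eq_comp, inner_tensorRep_star]
    calc ‖tensorRep π ρ t ξ‖ ^ 2
        = ‖inner ℂ (tensorRep π ρ t ξ) (tensorRep π ρ t ξ)‖ := by
          rw [sq]
          exact (norm_inner_self_complex (tensorRep π ρ t ξ)).symm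
      _ = ‖inner ℂ (tensorRep π ρ (star t * t) ξ) ξ‖ := by rw [e]
      _ ≤ (‖tensorRep π ρ (star t * t)‖ * ‖ξ‖) * ‖ξ‖ :=
          (norm_inner_le_norm _ _).trans
            (mul_le_mul_of_nonneg_right (ContinuousLinearMap.le_opNorm _ _) (norm_nonneg _))
      _ = ‖tensorRep π ρ (star t * t)‖ * ‖ξ‖ ^ 2 := by ring
  calc _ ≤ (Real.sqrt ‖tensorRep π ρ (star t * t)‖) ^ 2 := by gcongr
    _ = _ := Real.sq_sqrt h0

/-- The spatial seminorm as a ring seminorm. -/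
def spatialSeminorm (A B : Type v) [CStarAlgebra A] [CStarAlgebra B] :
    RingSeminorm (AlgTensor A B) where
  toFun := spatialNorm
  map_zero' := le_antisymm
    (spatialNorm_le le_rfl fun π ρ => by rw [map_zero, ContinuousLinearMap.opNorm_zero])
    (spatialNorm_nonneg 0)
  add_le' s t := spatialNorm_le (add_nonneg (spatialNorm_nonneg s) (spatialNorm_nonneg t))
    fun π ρ => by
      rw [map_add]
      exact (ContinuousLinearMap.opNorm_add_le _ _).trans
        (add_le_add (norm_tensorRep_le π ρ s) (norm_tensorRep_le π ρ t))
  mul_le' s t := spatialNorm_le (mul_nonneg (spatialNorm_nonneg s) (spatialNorm_nonneg t))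
    fun π ρ => by
      rw [map_mul]
      exact (ContinuousLinearMap.opNorm_comp_le _ _).trans
        (mul_le_mul (norm_tensorRep_le π ρ s) (norm_tensorRep_le π ρ t)
          (ContinuousLinearMap.opNorm_nonneg _)
          (spatialNorm_nonneg s))
  neg' t := by
    unfold spatialNorm
    congr 1
    funext p
    rw [map_neg, ContinuousLinearMap.opNorm_neg]

instance : SeminormedRing (AlgTensor A B) := (spatialSeminorm A B).toSeminormedRing

theorem AlgTensor.norm_def (t : AlgTensor A B) : ‖t‖ = spatialNorm t := rfl

instance : NormedAlgebra ℂ (AlgTensor A B) where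
  norm_smul_le c t := spatialNorm_le (by positivity) fun π ρ => by
    rw [map_smul]
    exact (ContinuousLinearMap.opNorm_smul_le _ _).trans <| mul_le_mul_of_nonneg_left (norm_tensorRep_le π ρ t) (norm_nonneg c)

theorem AlgTensor.norm_star (t : AlgTensor A B) : ‖star t‖ = ‖t‖ := by
  have h : ∀ t : AlgTensor A B, ‖star t‖ ≤ ‖t‖ := fun t =>
    spatialNorm_le (norm_nonneg _) fun π ρ =>
      (norm_tensorRep_star_le π ρ t).trans (norm_tensorRep_le π ρ t)
  exact le_antisymm (h t) (by simpa using h (star t))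

theorem AlgTensor.norm_mul_self_le (t : AlgTensor A B) : ‖t‖ * ‖t‖ ≤ ‖star t * t‖ := by
  have h : ‖t‖ ≤ Real.sqrt ‖star t * t‖ := spatialNorm_le (Real.sqrt_nonneg _) fun π ρ =>
    Real.le_sqrt_of_sq_le ((norm_tensorRep_sq_le π ρ t).trans (norm_tensorRep_le π ρ _))
  calc ‖t‖ * ‖t‖ ≤ Real.sqrt ‖star t * t‖ * Real.sqrt ‖star t * t‖ := by gcongr
    _ = _ := Real.mul_self_sqrt (norm_nonneg _)

end Algebraic

/-- The completed spatial tensor product `A ⊗ B` of two unital C*-algebras. -/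
def SpatialTensor (A B : Type v) [CStarAlgebra A] [CStarAlgebra B] : Type v :=
  UniformSpace.Completion (AlgTensor A B)

namespace SpatialTensor

open UniformSpace

variable {A B C : Type v} [CStarAlgebra A] [CStarAlgebra B] [CStarAlgebra C]

instance : NormedRing (SpatialTensor A B) :=
  inferInstanceAs (NormedRing (Completion (AlgTensor A B)))
instance : CompleteSpace (SpatialTensor A B) :=
  inferInstanceAs (CompleteSpace (Completion (AlgTensor A B)))
instance : Algebra ℂ (SpatialTensor A B) :=
  inferInstanceAs (Algebra ℂ (Completion (AlgTensor A B)))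
instance : NormedAlgebra ℂ (SpatialTensor A B) where
  norm_smul_le := norm_smul_le (α := ℂ) (β := Completion (AlgTensor A B))

/-- The canonical map `A ⊙ B → A ⊗ B`. -/
def ofAlg : AlgTensor A B →L[ℂ] SpatialTensor A B :=
  (Completion.toComplL : AlgTensor A B →L[ℂ] Completion (AlgTensor A B))

theorem norm_ofAlg (t : AlgTensor A B) : ‖(ofAlg t : SpatialTensor A B)‖ = ‖t‖ :=
  Completion.norm_coe t

theorem ofAlg_mul (s t : AlgTensor A B) :
    (ofAlg (s * t) : SpatialTensor A B) = ofAlg s * ofAlg t := Completion.coe_mul s t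

theorem ofAlg_one : (ofAlg 1 : SpatialTensor A B) = 1 := rfl

theorem denseRange_ofAlg : DenseRange (ofAlg : AlgTensor A B → SpatialTensor A B) :=
  Completion.denseRange_coe

theorem induction {p : SpatialTensor A B → Prop} (hc : IsClosed {z | p z})
    (h : ∀ t : AlgTensor A B, p (ofAlg t)) (z : SpatialTensor A B) : p z :=
  denseRange_ofAlg.induction_on z hc h

instance : Star (SpatialTensor A B) where
  star := Completion.map (star : AlgTensor A B → AlgTensor A B)

theorem isometry_star_alg : Isometry (star : AlgTensor A B → AlgTensor A B) :=
  (AddMonoidHomClass.isometry_iff_norm (starAddEquiv : AlgTensor A B ≃+ AlgTensor A B)).2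
    AlgTensor.norm_star

theorem continuous_star' : Continuous (star : SpatialTensor A B → SpatialTensor A B) :=
  Completion.continuous_map

theorem star_ofAlg (t : AlgTensor A B) :
    star (ofAlg t : SpatialTensor A B) = ofAlg (star t) :=
  Completion.map_coe isometry_star_alg.uniformContinuous t

theorem star_add' (z w : SpatialTensor A B) : star (z + w) = star z + star w := by
  induction z using SpatialTensor.induction with
  | hc =>
    exact isClosed_eq (continuous_star'.comp (continuous_add_const w))
      (continuous_star'.add continuous_const)
  | h s =>
    induction w using SpatialTensor.induction with
    | hc =>
      exact isClosed_eq (continuous_star'.comp (continuous_const_add _))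
        (continuous_const.add continuous_star')
    | h t => rw [← map_add, star_ofAlg, star_add, map_add, star_ofAlg, star_ofAlg]

instance : StarRing (SpatialTensor A B) where
  star_involutive z := by
    induction z using SpatialTensor.induction with
    | hc => exact isClosed_eq (continuous_star'.comp continuous_star') continuous_id
    | h t => rw [star_ofAlg, star_ofAlg, star_star]
  star_mul z w := by
    induction z using SpatialTensor.induction with
    | hc =>
      exact isClosed_eq (continuous_star'.comp (continuous_mul_const w))
        (continuous_const.mul continuous_star')
    | h s =>
      induction w using SpatialTensor.induction with
      | hc =>
        exact isClosed_eq (continuous_star'.comp (continuous_const_mul _))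
          (continuous_star'.mul continuous_const)
      | h t => rw [← ofAlg_mul, star_ofAlg, star_mul, ofAlg_mul, star_ofAlg, star_ofAlg]
  star_add := star_add'

instance : StarModule ℂ (SpatialTensor A B) where
  star_smul c z := by
    induction z using SpatialTensor.induction with
    | hc =>
      exact isClosed_eq (continuous_star'.comp (continuous_const_smul c))
        (continuous_star'.const_smul (star c))
    | h s => rw [← map_smul, star_ofAlg, star_smul, map_smul, star_ofAlg]

instance : CStarRing (SpatialTensor A B) where
  norm_mul_self_le z := by
    induction z using SpatialTensor.induction with
    | hc =>
      exact isClosed_le (continuous_norm.mul continuous_norm)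
        ((continuous_star'.mul continuous_id).norm)
    | h t =>
      rw [star_ofAlg, ← ofAlg_mul, norm_ofAlg, norm_ofAlg]
      exact AlgTensor.norm_mul_self_le t

instance : CStarAlgebra (SpatialTensor A B) where

/-- The usual order of a C*-algebra: `z ≤ w` iff `w - z` is positive. -/
instance : PartialOrder (SpatialTensor A B) := CStarAlgebra.spectralOrder _
instance : StarOrderedRing (SpatialTensor A B) := CStarAlgebra.spectralOrderedRing _

/-- The elementary tensor `a ⊗ b`. -/
def tmul (a : A) (b : B) : SpatialTensor A B := ofAlg (AlgTensor.mk a b)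

/-- The unital `*`-homomorphism `A → A ⊗ B`, `a ↦ a ⊗ 1`. -/
def inl : A →⋆ₐ[ℂ] SpatialTensor A B where
  toFun a := tmul a 1
  map_one' := rfl
  map_mul' a a' := by
    rw [tmul, tmul, tmul, ← ofAlg_mul, AlgTensor.mk_mul_mk, one_mul]
  map_zero' := by
    have : (AlgTensor.mk 0 1 : AlgTensor A B) = 0 := TensorProduct.zero_tmul A (1 : B)
    rw [tmul, this, map_zero]
  map_add' a a' := by
    have : (AlgTensor.mk (a + a') 1 : AlgTensor A B) = AlgTensor.mk a 1 + AlgTensor.mk a' 1 :=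
      TensorProduct.add_tmul a a' (1 : B)
    rw [tmul, tmul, tmul, this, map_add]
  commutes' c := by
    have : (AlgTensor.mk (algebraMap ℂ A c) 1 : AlgTensor A B) = c • AlgTensor.mk 1 1 := by
      rw [Algebra.algebraMap_eq_smul_one]
      exact TensorProduct.smul_tmul' c (1 : A) (1 : B)
    rw [tmul, this, map_smul, Algebra.algebraMap_eq_smul_one]
    rfl
  map_star' a := by
    rw [tmul, tmul, star_ofAlg, AlgTensor.star_mk, star_one]

/-- The unital `*`-homomorphism `B → A ⊗ B`, `b ↦ 1 ⊗ b`. -/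
def inr : B →⋆ₐ[ℂ] SpatialTensor A B where
  toFun b := tmul 1 b
  map_one' := rfl
  map_mul' b b' := by
    rw [tmul, tmul, tmul, ← ofAlg_mul, AlgTensor.mk_mul_mk, one_mul]
  map_zero' := by
    have : (AlgTensor.mk 1 0 : AlgTensor A B) = 0 := TensorProduct.tmul_zero B (1 : A)
    rw [tmul, this, map_zero]
  map_add' b b' := by
    have : (AlgTensor.mk 1 (b + b') : AlgTensor A B) = AlgTensor.mk 1 b + AlgTensor.mk 1 b' :=
      TensorProduct.tmul_add (1 : A) b b'
    rw [tmul, tmul, tmul, this, map_add]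
  commutes' c := by
    have : (AlgTensor.mk 1 (algebraMap ℂ B c) : AlgTensor A B) = c • AlgTensor.mk 1 1 := by
      rw [Algebra.algebraMap_eq_smul_one]
      exact TensorProduct.tmul_smul c (1 : A) (1 : B)
    rw [tmul, this, map_smul, Algebra.algebraMap_eq_smul_one]
    rfl
  map_star' b := by
    rw [tmul, tmul, star_ofAlg, AlgTensor.star_mk, star_one]

/-- The flip `A ⊙ B → B ⊙ A`. -/
def flipAlg : AlgTensor A B →ₗ[ℂ] AlgTensor B A := (TensorProduct.comm ℂ A B).toLinearMap

theorem flipAlg_mk (a : A) (b : B) :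
    flipAlg (AlgTensor.mk a b) = AlgTensor.mk b a := rfl

theorem norm_flipAlg_le (t : AlgTensor A B) : ‖flipAlg t‖ ≤ ‖t‖ := by
  refine spatialNorm_le (norm_nonneg _) fun ρ π => ?_
  refine le_trans ?_ (norm_tensorRep_le π ρ t)
  have key : ∀ ξ : ρ.space ⊗[ℂ] π.space, tensorRep ρ π (flipAlg t) ξ
      = TensorProduct.comm ℂ π.space ρ.space
          (tensorRep π ρ t (TensorProduct.comm ℂ ρ.space π.space ξ)) := by
    intro ξ
    induction t using AlgTensor.induction with
    | zero => simp
    | add s s' h h' => simp [h, h']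
    | mk a b =>
      induction ξ using TensorProduct.induction_on with
      | zero => simp
      | add s s' h h' => simp only [map_add, h, h']
      | tmul x y =>
        rw [flipAlg_mk, tensorRep_mk_tmul, TensorProduct.comm_tmul, tensorRep_mk_tmul,
          TensorProduct.comm_tmul]
  refine ContinuousLinearMap.opNorm_le_bound _ (ContinuousLinearMap.opNorm_nonneg _) fun ξ => ?_
  rw [key, TensorProduct.norm_comm]
  refine (ContinuousLinearMap.le_opNorm _ _).trans_eq ?_
  rw [TensorProduct.norm_comm]

/-- The flip `A ⊗ B → B ⊗ A`, `a ⊗ b ↦ b ⊗ a`. -/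
def flip : SpatialTensor A B →L[ℂ] SpatialTensor B A :=
  (flipAlg.mkContinuous 1 fun t => by rw [one_mul]; exact norm_flipAlg_le t :
    AlgTensor A B →L[ℂ] AlgTensor B A).completion

theorem flip_tmul (a : A) (b : B) : flip (tmul a b) = tmul b a := by
  refine (ContinuousLinearMap.completion_apply_coe _ _).trans ?_
  exact congrArg ofAlg (flipAlg_mk a b)

/-- The map `α ⊗ id : A ⊙ C → B ⊙ C`. -/
def mapLeftAlg (C : Type v) [CStarAlgebra C] (α : A →⋆ₐ[ℂ] B) :
    AlgTensor A C →ₗ[ℂ] AlgTensor B C :=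
  TensorProduct.map (α.toAlgHom.toLinearMap : A →ₗ[ℂ] B) (LinearMap.id : C →ₗ[ℂ] C)

theorem mapLeftAlg_mk (α : A →⋆ₐ[ℂ] B) (a : A) (c : C) :
    mapLeftAlg C α (AlgTensor.mk a c) = AlgTensor.mk (α a) c :=
  TensorProduct.map_tmul _ _ a c

theorem norm_mapLeftAlg_le (α : A →⋆ₐ[ℂ] B) (t : AlgTensor A C) :
    ‖mapLeftAlg C α t‖ ≤ ‖t‖ := by
  refine spatialNorm_le (norm_nonneg _) fun π ρ => ?_
  have key : tensorRep π ρ (mapLeftAlg C α t) = tensorRep (π.comap α) ρ t := by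
    induction t using AlgTensor.induction with
    | zero => rw [map_zero, map_zero]; exact (map_zero (tensorRep (π.comap α) ρ)).symm
    | add s s' h h' =>
      rw [map_add, map_add, h, h']
      exact (map_add (tensorRep (π.comap α) ρ) s s').symm
    | mk a c =>
      rw [mapLeftAlg_mk, tensorRep_mk]
      exact (tensorRep_mk (π.comap α) ρ a c).symm
  rw [key]
  exact norm_tensorRep_le (π.comap α) ρ t

/-- The map `α ⊗ id : A ⊗ C → B ⊗ C` for a unital `*`-homomorphism `α : A → B`. -/
def mapLeft (C : Type v) [CStarAlgebra C] (α : A →⋆ₐ[ℂ] B) :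
    SpatialTensor A C →L[ℂ] SpatialTensor B C :=
  ((mapLeftAlg C α).mkContinuous 1 fun t => by rw [one_mul]; exact norm_mapLeftAlg_le α t :
    AlgTensor A C →L[ℂ] AlgTensor B C).completion

theorem mapLeft_tmul (α : A →⋆ₐ[ℂ] B) (a : A) (c : C) :
    mapLeft C α (tmul a c) = tmul (α a) c := by
  refine (ContinuousLinearMap.completion_apply_coe _ _).trans ?_
  exact congrArg ofAlg (mapLeftAlg_mk α a c)

/-- The slice map `φ ⊗ id : A ⊙ B → B`. -/
def sliceAlg (φ : CState A) : AlgTensor A B →ₗ[ℂ] B :=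
  TensorProduct.lift ((LinearMap.lsmul ℂ B).comp (φ.functional : A →ₗ[ℂ] ℂ))

theorem sliceAlg_mk (φ : CState A) (a : A) (b : B) :
    sliceAlg φ (AlgTensor.mk a b) = φ.functional a • b :=
  TensorProduct.lift.tmul a b

theorem norm_sliceAlg_le (φ : CState A) (t : AlgTensor A B) : ‖sliceAlg φ t‖ ≤ ‖t‖ := by
  obtain ⟨π, ξ, hξ⟩ := φ.exists_rep
  obtain ⟨ρ, hρ⟩ := exists_rep_norm (sliceAlg φ t)
  have hξ1 := CState.norm_vector hξ
  refine hρ.trans ?_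
  have key : ∀ η ζ : ρ.space, inner ℂ ζ (ρ.hom (sliceAlg φ t) η)
      = inner ℂ (ξ ⊗ₜ[ℂ] ζ) (tensorRep π ρ t (ξ ⊗ₜ[ℂ] η)) := by
    intro η ζ
    clear hρ
    induction t using AlgTensor.induction with
    | zero => simp
    | add s s' h h' =>
      rw [map_add, map_add, map_add, add_apply, add_apply, inner_add_right, inner_add_right, h, h']
    | mk a b =>
      rw [sliceAlg_mk, tensorRep_mk_tmul, TensorProduct.inner_tmul, map_smul, hξ]
      simp
  refine ContinuousLinearMap.opNorm_le_bound _ (norm_nonneg _) fun η => ?_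
  set ζ := ρ.hom (sliceAlg φ t) η with hζ
  have h0 := ContinuousLinearMap.opNorm_nonneg (tensorRep π ρ t)
  have h1 : ‖ζ‖ * ‖ζ‖ ≤ ‖t‖ * ‖η‖ * ‖ζ‖ := by
    calc ‖ζ‖ * ‖ζ‖ = ‖inner ℂ ζ ζ‖ := (norm_inner_self_complex ζ).symm
      _ = ‖inner ℂ (ξ ⊗ₜ[ℂ] ζ) (tensorRep π ρ t (ξ ⊗ₜ[ℂ] η))‖ := by
          conv_lhs => rw [hζ]
          rw [← hζ, key]
      _ ≤ ‖ξ ⊗ₜ[ℂ] ζ‖ * (‖tensorRep π ρ t‖ * ‖ξ ⊗ₜ[ℂ] η‖) :=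
          (norm_inner_le_norm _ _).trans
            (mul_le_mul_of_nonneg_left (ContinuousLinearMap.le_opNorm _ _) (norm_nonneg _))
      _ = ‖tensorRep π ρ t‖ * ‖η‖ * ‖ζ‖ := by
          rw [TensorProduct.norm_tmul, TensorProduct.norm_tmul, hξ1]; ring
      _ ≤ ‖t‖ * ‖η‖ * ‖ζ‖ := by
          gcongr
          exact norm_tensorRep_le π ρ t
  rcases (norm_nonneg ζ).eq_or_lt with h2 | h2
  · rw [← h2]; positivity
  · exact le_of_mul_le_mul_right h1 h2

/-- The slice map `φ ⊗ id : A ⊗ B → B` of a state `φ` of `A`. -/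
def slice (φ : CState A) : SpatialTensor A B →L[ℂ] B :=
  ((sliceAlg φ).mkContinuous 1 fun t => by rw [one_mul]; exact norm_sliceAlg_le φ t :
    AlgTensor A B →L[ℂ] B).fromCompletion

theorem slice_tmul (φ : CState A) (a : A) (b : B) :
    slice φ (tmul a b) = φ.functional a • b := by
  refine (ContinuousLinearMap.fromCompletion_apply_coe _ _).trans ?_
  exact sliceAlg_mk φ a b

/-- The product functional `φ ⊗ ψ` on `A ⊗ B`. -/
def prodState (φ : CState A) (ψ : CState B) : SpatialTensor A B →L[ℂ] ℂ :=
  ψ.functional.comp (slice φ)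

theorem prodState_tmul (φ : CState A) (ψ : CState B) (a : A) (b : B) :
    prodState φ ψ (tmul a b) = φ.functional a * ψ.functional b := by
  rw [prodState, ContinuousLinearMap.comp_apply, slice_tmul, map_smul, smul_eq_mul]

/-- The `*`-morphism `A ⊗ C → (A ⊗ B) ⊗ C`, `a ⊗ c ↦ (a ⊗ 1) ⊗ c`, putting the unit in the
middle. -/
def midUnit (A B C : Type v) [CStarAlgebra A] [CStarAlgebra B] [CStarAlgebra C] :
    SpatialTensor A C →L[ℂ] SpatialTensor (SpatialTensor A B) C :=
  mapLeft C (inl : A →⋆ₐ[ℂ] SpatialTensor A B)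

/-- The map `z ↦ z ⊗ 1`, `A ⊗ B → (A ⊗ B) ⊗ C`. -/
def rightUnit (A B C : Type v) [CStarAlgebra A] [CStarAlgebra B] [CStarAlgebra C] :
    SpatialTensor A B →⋆ₐ[ℂ] SpatialTensor (SpatialTensor A B) C :=
  inl

/-- The map `z ↦ 1 ⊗ z`, `B ⊗ C → A ⊗ B ⊗ C = (A ⊗ B) ⊗ C`, that is
`b ⊗ c ↦ (1 ⊗ b) ⊗ c`. -/
def leftUnit (A B C : Type v) [CStarAlgebra A] [CStarAlgebra B] [CStarAlgebra C] :
    SpatialTensor B C →L[ℂ] SpatialTensor (SpatialTensor A B) C :=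
  mapLeft C (inr : B →⋆ₐ[ℂ] SpatialTensor A B)

end SpatialTensor

open SpatialTensor

section Mof

variable {X : Type u} {A : X → Type v} [∀ x, CStarAlgebra (A x)]

/-- The operator fields on the bundle `{A x ⊗ A x'}` over `X × X`. -/
abbrev BiField (A : X → Type v) [∀ x, CStarAlgebra (A x)] : Type (max u v) :=
  ∀ x x' : X, SpatialTensor (A x) (A x')

/-- Metric operator fields on the bundle `{A x}` of C*-algebras. -/
structure IsMof (D : BiField A) : Prop where
  metricStates : ∃ μ : ∀ x, CState (A x), ∀ x, prodState (μ x) (μ x) (D x x) = 0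
  pos : ∀ x x', x ≠ x' → 0 ≤ D x x' ∧ IsUnit (D x x')
  symm : ∀ x x', D x x' = SpatialTensor.flip (D x' x)
  triangle : ∀ x x' x'', midUnit (A x) (A x') (A x'') (D x x'') ≤
    rightUnit (A x) (A x') (A x'') (D x x') + leftUnit (A x) (A x') (A x'') (D x' x'')

/-- The C*-subalgebra `Z(A) ⊗ Z(B)` of `A ⊗ B`, as a set: the closed linear span of the
elementary tensors of central elements. -/
def centerTensor (A B : Type v) [CStarAlgebra A] [CStarAlgebra B] : Set (SpatialTensor A B) :=
  closure (Submodule.span ℂ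
    {z | ∃ a ∈ Set.center A, ∃ b ∈ Set.center B, z = tmul a b} : Set (SpatialTensor A B))

/-- `D` takes its values in `Z(A x) ⊗ Z(A x')`. -/
def IsCentral (D : BiField A) : Prop := ∀ x x', D x x' ∈ centerTensor (A x) (A x')

/-- `D` is the scalar valued mof `(x, x') ↦ d x x' • (1 ⊗ 1)` of an ordinary metric `d`. -/
def IsScalarMof (D : BiField A) : Prop :=
  ∃ d : MetricSpace X, ∀ x x', D x x' = ((d.dist x x' : ℝ) : ℂ) • (1 : SpatialTensor (A x) (A x'))

/-- `D` is a bounded field: `sup ‖D x x'‖ < ∞`. -/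
def IsBoundedBiField (D : BiField A) : Prop := ∃ c : ℝ, ∀ x x', ‖D x x'‖ ≤ c

/-- The scalar valued operator field `x ↦ f x • 1` of a function `f : X → ℂ`. -/
def scalarField (A : X → Type v) [∀ x, CStarAlgebra (A x)] (f : X → ℂ) : ∀ x, A x :=
  fun x => f x • (1 : A x)

/-- The operator field `f` is scalar valued. -/
def IsScalarField (f : ∀ x, A x) : Prop := ∃ c : X → ℂ, f = scalarField A c

/-- The seminorm `‖f‖_D = sup_{x ≠ x'} ‖D(x,x')^{-1/2} (f x ⊗ 1 - 1 ⊗ f x') D(x,x')^{-1/2}‖`, with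
values in `[0, ∞]`; the powers are those of the continuous functional calculus. -/
def lipSeminorm (D : BiField A) (f : ∀ x, A x) : ℝ≥0∞ :=
  ⨆ (x : X) (x' : X) (_ : x ≠ x'),
    ‖D x x' ^ (-(1 / 2) : ℝ) * (inl (f x) - inr (f x')) * D x x' ^ (-(1 / 2) : ℝ)‖ₑ

/-- `f` is a Lipschitz operator field with respect to `D`. -/
def IsLipschitzField (D : BiField A) (f : ∀ x, A x) : Prop := lipSeminorm D f < ⊤

/-- The Lipschitz algebra `Lip(D)`: the bounded Lipschitz operator fields commuting with `D`. -/
def LipAlgebra (D : BiField A) : Set (∀ x, A x) :=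
  {f | (∃ c : ℝ, ∀ x, ‖f x‖ ≤ c) ∧ IsLipschitzField D f ∧ ∀ x x', Commute (D x x') (inl (f x))}

open Classical in
/-- The ordinary metric `D^{‖·‖}`: it is `‖D x x'‖` for `x ≠ x'` and `0` for `x = x'`. -/
def normMetric (D : BiField A) (x x' : X) : ℝ := if x = x' then 0 else ‖D x x'‖

/-- `Lip(d)` for an ordinary metric `d`: the bounded functions `f : X → ℂ` such that
`sup_{x ≠ x'} |f x - f x'| / d x x' < ∞`. -/
def LipFunctions (d : X → X → ℝ) : Set (X → ℂ) :=
  {f | (∃ c : ℝ, ∀ x, ‖f x‖ ≤ c) ∧ ∃ c : ℝ, ∀ x x', x ≠ x' → ‖f x - f x'‖ / d x x' ≤ c}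

/-- The operator field `x ↦ (μ ⊗ id) D(x₀, x)`. -/
def stateField (D : BiField A) (x₀ : X) (μ : CState (A x₀)) : ∀ x, A x :=
  fun x => slice μ (D x₀ x)

end Mof

end

noncomputable section

/-! Write `d(φ, ψ) = (φ ⊗ ψ) D(x, x')` for states `φ` of `A x` and `ψ` of `A x'`. The mof axioms
make `d` symmetric and give it the triangle inequality, because product states are positive and the
units inserted in the triple tensor product have value `1`. The field `f(x) = (μ ⊗ id) D(x₀, x)`
satisfies `φ(f(x)) = d(μ, φ)`, so the classical estimate `|d(μ, φ) - d(μ, ψ)| ≤ d(φ, ψ)` says that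
`-D ≤ f(x) ⊗ 1 - 1 ⊗ f(x') ≤ D` holds after evaluation at every product state.

Centrality makes this an operator inequality (`nonneg_of_prodState_nonneg`). A spectral value of a
central element is the value of a character of the center. For `z ∈ Z(A) ⊗ Z(B)`, a Hahn–Banach
extension of that character restricts to states of `A` and of `B`, and by multiplicativity it agrees
with their product on `Z(A) ⊗ Z(B)`. So product states reach the whole spectrum of `z`
(`exists_prodState_eq_of_mem_spectrum`). Conjugating the two-sided bound by `D^{-1/2}` then gives
Lipschitz constant at most `1`.

If every such field were scalar, `d(φ, ψ)` would not depend on `ψ`, nor, by symmetry, on `φ`.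
Product states would then force each `D(x, x')` to be a scalar, and the mof axioms make these
scalars a metric (`isScalarMof_of_isScalarField`). Hence some field is not scalar. For bounded `D`
it lies in `Lip(D)`, outside the range of `f ↦ f̃`. -/

/-! ### Characters of the center and their extensions. -/

theorem Set.isClosed_center (E : Type*) [CStarAlgebra E] : IsClosed (Set.center E) := by
  have : Set.center E = ⋂ b : E, {a | b * a = a * b} := by
    ext a
    rw [Semigroup.mem_center_iff, Set.mem_iInter]
    rfl
  rw [this]
  exact isClosed_iInter fun b => isClosed_eq (continuous_const_mul b) (continuous_mul_const b)

/-- A spectral value of a central element of a unital C*-algebra is attained by a contractive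
unital functional that is multiplicative on the center. -/
theorem exists_functional_of_mem_spectrum_of_mem_center {E : Type v} [CStarAlgebra E] {z : E}
    (hz : z ∈ Set.center E) {l : ℂ} (hl : l ∈ spectrum ℂ z) :
    ∃ g : E →L[ℂ] ℂ, g 1 = 1 ∧ (∀ a, ‖g a‖ ≤ ‖a‖) ∧ g z = l ∧
      ∀ a ∈ Set.center E, ∀ b ∈ Set.center E, g (a * b) = g a * g b := by
  -- In the zero algebra every element is a unit, so spectra are empty.
  have hE : Nontrivial E := by
    by_contra h
    rw [not_nontrivial_iff_subsingleton] at h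
    exact hl (isUnit_of_subsingleton _)
  let S : Subalgebra ℂ E := Subalgebra.center ℂ E
  -- The center is a commutative Banach algebra, so Gelfand theory provides characters.
  let _ : NormedCommRing S :=
    { (inferInstance : NormedRing S) with
      mul_comm := fun a b => Subtype.ext ((Subalgebra.mem_center_iff.1 b.2 a)) }
  have : CompleteSpace S := (Set.isClosed_center E).completeSpace_coe
  -- Only the easy inclusion of spectra is needed: an inverse in the center is an inverse in `E`.
  have hl' : l ∈ spectrum ℂ (⟨z, hz⟩ : S) := by
    intro hu
    apply hl
    exact hu.map S.val
  obtain ⟨χ, hχ⟩ := WeakDual.CharacterSpace.mem_spectrum_iff_exists.1 hl'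
  have hnorm : ∀ s : S, ‖χ s‖ ≤ ‖(s : E)‖ := fun s =>
    by
    have : NormOneClass S := ⟨CStarRing.norm_one (E := E)⟩
    have h : ‖χ s‖ ≤ ‖s‖ := spectrum.norm_le_norm_of_mem (AlgHom.apply_mem_spectrum χ s)
    exact h
  -- The character, viewed as a contractive functional on a subspace, is extended by Hahn–Banach
  -- without increasing its norm.
  let f : StrongDual ℂ (Subalgebra.toSubmodule S) :=
    (LinearMap.mkContinuous
      { toFun := fun s => χ (s : S)
        map_add' := fun s t => map_add χ (s : S) (t : S)
        map_smul' := fun c s => map_smul χ c (s : S) } 1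
      fun s => by rw [one_mul]; exact hnorm s)
  obtain ⟨g, hg, hgn⟩ := exists_extension_norm_eq _ f
  have hval : ∀ s : S, g (s : E) = χ s := fun s => hg s
  refine ⟨g, ?_, fun a => ?_, ?_, ?_⟩
  · rw [← map_one χ, ← hval]; rfl
  · have h1 : ‖g‖ ≤ 1 := hgn.trans_le (LinearMap.mkContinuous_norm_le _ zero_le_one _)
    exact (g.le_opNorm a).trans (mul_le_of_le_one_left (norm_nonneg _) h1)
  · rw [← hχ, ← hval]
  · intro a ha b hb
    have := map_mul χ ⟨a, ha⟩ ⟨b, hb⟩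
    rwa [← hval, ← hval, ← hval] at this

/-! ### Contractivity and positivity of states. -/

namespace CState

variable {A : Type v} [CStarAlgebra A]

/-- By GNS a state is a vector state at a unit vector, and representations are contractive. -/
theorem norm_functional_le (φ : CState A) (a : A) : ‖φ.functional a‖ ≤ ‖a‖ := by
  obtain ⟨π, ξ, h⟩ := φ.exists_rep
  have hξ := CState.norm_vector h
  rw [← h a]
  calc ‖inner ℂ ξ (π.hom a ξ)‖ ≤ ‖ξ‖ * (‖π.hom a‖ * ‖ξ‖) :=
        (norm_inner_le_norm _ _).trans
          (mul_le_mul_of_nonneg_left (ContinuousLinearMap.le_opNorm _ _) (norm_nonneg _))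
    _ ≤ ‖a‖ := by
        rw [hξ, one_mul, mul_one]
        exact NonUnitalStarAlgHom.norm_apply_le _ _

/-- A contractive unital functional is a state. -/
def ofContractive (g : A →L[ℂ] ℂ) (h1 : g 1 = 1) (hg : ∀ a, ‖g a‖ ≤ ‖a‖) : CState A where
  functional := g
  apply_one := h1
  re_nonneg a := by
    let _ := CStarAlgebra.spectralOrder A
    have _ := CStarAlgebra.spectralOrderedRing A
    exact re_nonneg_of_contractive g h1 hg _ (star_mul_self_nonneg a)
  im_eq_zero a := im_eq_zero_of_contractive g h1 hg _ (IsSelfAdjoint.star_mul_self a)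

open scoped ComplexOrder in
theorem functional_nonneg [PartialOrder A] [StarOrderedRing A] (φ : CState A) {a : A}
    (ha : 0 ≤ a) : 0 ≤ φ.functional a := by
  obtain ⟨c, rfl⟩ := CStarAlgebra.nonneg_iff_eq_star_mul_self.1 ha
  exact Complex.nonneg_iff.2 ⟨φ.re_nonneg c, (φ.im_eq_zero c).symm⟩

end CState

/-! ### Product states and the structure maps of the tensor product. -/

namespace SpatialTensor

variable {A B C : Type v} [CStarAlgebra A] [CStarAlgebra B] [CStarAlgebra C]

theorem tmul_mul_tmul (a a' : A) (b b' : B) :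
    (tmul a b * tmul a' b' : SpatialTensor A B) = tmul (a * a') (b * b') := by
  rw [tmul, tmul, tmul, ← ofAlg_mul, AlgTensor.mk_mul_mk]

/-- Continuous linear maps on `A ⊗ B` that agree on elementary tensors are equal. -/
theorem continuousLinearMap_ext {F : Type*} [NormedAddCommGroup F] [NormedSpace ℂ F]
    {S T : SpatialTensor A B →L[ℂ] F} (h : ∀ a b, S (tmul a b) = T (tmul a b)) : S = T := by
  ext z
  induction z using SpatialTensor.induction with
  | hc => exact isClosed_eq S.continuous T.continuous
  | h t =>
    induction t using AlgTensor.induction with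
    | zero => simp only [map_zero]
    | mk a b => exact h a b
    | add s t hs ht => simp only [map_add, hs, ht]

theorem norm_slice_le (φ : CState A) (z : SpatialTensor A B) : ‖slice φ z‖ ≤ ‖z‖ := by
  induction z using SpatialTensor.induction with
  | hc => exact isClosed_le (slice φ).continuous.norm continuous_norm
  | h t =>
    rw [norm_ofAlg]
    exact (congrArg norm (ContinuousLinearMap.fromCompletion_apply_coe _ _)).trans_le
      (norm_sliceAlg_le φ t)

theorem prodState_one (φ : CState A) (ψ : CState B) :
    prodState φ ψ (1 : SpatialTensor A B) = 1 := by
  have := prodState_tmul φ ψ 1 1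
  rwa [φ.apply_one, ψ.apply_one, one_mul] at this

/-- The product of two states, as a state of the spatial tensor product. -/
def prodCState (φ : CState A) (ψ : CState B) : CState (SpatialTensor A B) :=
  CState.ofContractive (prodState φ ψ) (prodState_one φ ψ) fun z =>
    (ψ.norm_functional_le _).trans (norm_slice_le φ z)

theorem prodState_flip (φ : CState A) (ψ : CState B) (z : SpatialTensor B A) :
    prodState φ ψ (flip z) = prodState ψ φ z := by
  have : (prodState φ ψ).comp flip = prodState ψ φ := continuousLinearMap_ext fun b a => by
    rw [ContinuousLinearMap.comp_apply, flip_tmul, prodState_tmul, prodState_tmul, mul_comm]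
  exact congrArg (· z) this

theorem prodState_inl (φ : CState A) (ψ : CState B) (a : A) :
    prodState φ ψ (inl a) = φ.functional a :=
  (prodState_tmul φ ψ a 1).trans (by rw [ψ.apply_one, mul_one])

theorem prodState_inr (φ : CState A) (ψ : CState B) (b : B) :
    prodState φ ψ (inr b) = ψ.functional b :=
  (prodState_tmul φ ψ 1 b).trans (by rw [φ.apply_one, one_mul])

/-- The middle state meets only the inserted unit, where its value is `1`. With the analogous
identities for `leftUnit` and `rightUnit`, this turns the operator triangle inequality into a
numerical one. -/
theorem prodState_midUnit (φ : CState A) (ψ : CState B) (ω : CState C) (z : SpatialTensor A C) :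
    prodState (prodCState φ ψ) ω (midUnit A B C z) = prodState φ ω z := by
  have : (prodState (prodCState φ ψ) ω).comp (midUnit A B C) = prodState φ ω :=
    continuousLinearMap_ext fun a c => by
      rw [ContinuousLinearMap.comp_apply, midUnit, mapLeft_tmul, prodState_tmul, prodState_tmul]
      exact congrArg (· * ω.functional c) (prodState_inl φ ψ a)
  exact congrArg (· z) this

theorem prodState_leftUnit (φ : CState A) (ψ : CState B) (ω : CState C) (z : SpatialTensor B C) :
    prodState (prodCState φ ψ) ω (leftUnit A B C z) = prodState ψ ω z := by
  have : (prodState (prodCState φ ψ) ω).comp (leftUnit A B C) = prodState ψ ω :=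
    continuousLinearMap_ext fun a c => by
      rw [ContinuousLinearMap.comp_apply, leftUnit, mapLeft_tmul, prodState_tmul, prodState_tmul]
      exact congrArg (· * ω.functional c) (prodState_inr φ ψ a)
  exact congrArg (· z) this

theorem prodState_rightUnit (φ : CState A) (ψ : CState B) (ω : CState C)
    (z : SpatialTensor A B) :
    prodState (prodCState φ ψ) ω (rightUnit A B C z) = prodState φ ψ z :=
  prodState_inl (prodCState φ ψ) ω z

/-! ### The subspace `Z(A) ⊗ Z(B)`. -/

/-- Left and right multiplication by the tensor are continuous, so it is enough that they agree on
elementary tensors. -/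
theorem tmul_mem_center {a : A} (ha : a ∈ Set.center A) {b : B} (hb : b ∈ Set.center B) :
    (tmul a b : SpatialTensor A B) ∈ Set.center (SpatialTensor A B) := by
  rw [Semigroup.mem_center_iff] at ha hb ⊢
  have : ContinuousLinearMap.mul ℂ (SpatialTensor A B) (tmul a b) =
      (ContinuousLinearMap.mul ℂ (SpatialTensor A B)).flip (tmul a b) :=
    continuousLinearMap_ext fun a' b' => by
      simp only [ContinuousLinearMap.mul_apply', ContinuousLinearMap.flip_apply, tmul_mul_tmul,
        ha, hb]
  exact fun z => (congrArg (· z) this).symm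

theorem centerTensor_induction {p : SpatialTensor A B → Prop} (hc : IsClosed {z | p z})
    (tmul : ∀ a ∈ Set.center A, ∀ b ∈ Set.center B, p (tmul a b)) (zero : p 0)
    (add : ∀ z w, p z → p w → p (z + w)) (smul : ∀ (c : ℂ) z, p z → p (c • z))
    {z : SpatialTensor A B} (hz : z ∈ centerTensor A B) : p z := by
  refine closure_minimal (t := {z | p z}) (fun w hw => ?_) hc hz
  induction hw using Submodule.span_induction with
  | mem x hx => obtain ⟨a, ha, b, hb, rfl⟩ := hx; exact tmul a ha b hb
  | zero => exact zero
  | add x y _ _ hx hy => exact add x y hx hy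
  | smul c x _ hx => exact smul c x hx

theorem centerTensor_subset_center : centerTensor A B ⊆ Set.center (SpatialTensor A B) := by
  intro z hz
  refine centerTensor_induction (p := (· ∈ Set.center (SpatialTensor A B))) (Set.isClosed_center _)
    (fun a ha b hb => tmul_mem_center ha hb)
    (Subalgebra.center ℂ (SpatialTensor A B)).zero_mem
    (fun z w hz hw => (Subalgebra.center ℂ (SpatialTensor A B)).add_mem hz hw)
    (fun c z hz => (Subalgebra.center ℂ (SpatialTensor A B)).smul_mem hz c) hz

/-- This keeps the fields `(μ ⊗ id) D(x₀, ·)` in the centers, so that `f(x) ⊗ 1 - 1 ⊗ f(x')` can be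
tested by product states. It holds because a slice of `a ⊗ b` is a multiple of `b` and the center is
closed. -/
theorem slice_mem_center (φ : CState A) {z : SpatialTensor A B} (hz : z ∈ centerTensor A B) :
    slice φ z ∈ Set.center B := by
  refine centerTensor_induction (p := fun z => slice φ z ∈ Set.center B)
    ((Set.isClosed_center B).preimage (slice φ).continuous) (fun a _ b hb => ?_) ?_ ?_ ?_ hz
  · rw [slice_tmul]
    exact (Subalgebra.center ℂ B).smul_mem hb _
  · rw [map_zero]
    exact (Subalgebra.center ℂ B).zero_mem
  · intro z w hz hw
    rw [map_add]
    exact (Subalgebra.center ℂ B).add_mem hz hw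
  · intro c z hz
    rw [map_smul]
    exact (Subalgebra.center ℂ B).smul_mem hz c

/-! ### Product states as a test for positivity. -/

/-- The closed subspace `Z(A) ⊗ Z(B)` of `A ⊗ B`. -/
def centerSubmodule (A B : Type v) [CStarAlgebra A] [CStarAlgebra B] :
    Submodule ℂ (SpatialTensor A B) :=
  (Submodule.span ℂ
    {z | ∃ a ∈ Set.center A, ∃ b ∈ Set.center B, z = tmul a b}).topologicalClosure

theorem tmul_mem_centerSubmodule {a : A} (ha : a ∈ Set.center A) {b : B}
    (hb : b ∈ Set.center B) : tmul a b ∈ centerSubmodule A B :=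
  subset_closure (Submodule.subset_span ⟨a, ha, b, hb, rfl⟩)

/-- Every spectral value of an element of `Z(A) ⊗ Z(B)` is taken by a product state. -/
theorem exists_prodState_eq_of_mem_spectrum {z : SpatialTensor A B} (hz : z ∈ centerTensor A B)
    {l : ℂ} (hl : l ∈ spectrum ℂ z) :
    ∃ (φ : CState A) (ψ : CState B), prodState φ ψ z = l := by
  obtain ⟨g, g1, hg, hgz, hmul⟩ :=
    exists_functional_of_mem_spectrum_of_mem_center (centerTensor_subset_center hz) hl
  -- The restrictions of `g` to `A ⊗ 1` and `1 ⊗ B` are contractive and unital, hence states of the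
  -- full algebras `A` and `B`.
  let L : A →L[ℂ] ℂ := LinearMap.mkContinuous
    ((g : SpatialTensor A B →ₗ[ℂ] ℂ).comp (inl : A →⋆ₐ[ℂ] SpatialTensor A B).toAlgHom.toLinearMap)
    1 fun a => by
      rw [one_mul]
      exact (hg _).trans (NonUnitalStarAlgHom.norm_apply_le (inl : A →⋆ₐ[ℂ] SpatialTensor A B) a)
  let R : B →L[ℂ] ℂ := LinearMap.mkContinuous
    ((g : SpatialTensor A B →ₗ[ℂ] ℂ).comp (inr : B →⋆ₐ[ℂ] SpatialTensor A B).toAlgHom.toLinearMap)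
    1 fun a => by
      rw [one_mul]
      exact (hg _).trans (NonUnitalStarAlgHom.norm_apply_le (inr : B →⋆ₐ[ℂ] SpatialTensor A B) a)
  have hL : ∀ a, L a = g (inl a) := fun _ => rfl
  have hR : ∀ b, R b = g (inr b) := fun _ => rfl
  let φ : CState A := CState.ofContractive L (by rw [hL, map_one, g1]) fun a => by
    rw [hL]
    exact (hg _).trans (NonUnitalStarAlgHom.norm_apply_le (inl : A →⋆ₐ[ℂ] SpatialTensor A B) a)
  let ψ : CState B := CState.ofContractive R (by rw [hR, map_one, g1]) fun a => by
    rw [hR]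
    exact (hg _).trans (NonUnitalStarAlgHom.norm_apply_le (inr : B →⋆ₐ[ℂ] SpatialTensor A B) a)
  refine ⟨φ, ψ, ?_⟩
  rw [← hgz]
  refine centerTensor_induction (p := fun z => prodState φ ψ z = g z)
    (isClosed_eq (prodState φ ψ).continuous g.continuous) (fun a ha b hb => ?_)
    (by simp only [map_zero]) (fun z w hz hw => by simp only [map_add, hz, hw])
    (fun c z hz => by simp only [map_smul, hz]) hz
  -- Both factors of `(a ⊗ 1)(1 ⊗ b)` are central, so `g` is multiplicative on them.
  have e : (tmul a b : SpatialTensor A B) = tmul a 1 * tmul 1 b := by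
    rw [tmul_mul_tmul, mul_one, one_mul]
  rw [prodState_tmul, e, hmul _ (tmul_mem_center ha (Set.one_mem_center)) _
    (tmul_mem_center Set.one_mem_center hb)]
  rfl

open scoped ComplexOrder in
/-- Positivity in `Z(A) ⊗ Z(B)` is detected by product states. -/
theorem nonneg_of_prodState_nonneg {z : SpatialTensor A B} (hz : z ∈ centerTensor A B)
    (h : ∀ (φ : CState A) (ψ : CState B), 0 ≤ prodState φ ψ z) : 0 ≤ z := by
  have hspec : ∀ l ∈ spectrum ℂ z, 0 ≤ l := by
    intro l hl
    obtain ⟨φ, ψ, rfl⟩ := exists_prodState_eq_of_mem_spectrum hz hl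
    exact h φ ψ
  -- A central element is normal. A normal element with real spectrum is self-adjoint, and it is
  -- positive once the spectrum is nonnegative.
  have hn : IsStarNormal z :=
    ⟨((Semigroup.mem_center_iff.1 (centerTensor_subset_center hz)) (star z))⟩
  have hsa : IsSelfAdjoint z := by
    rw [isSelfAdjoint_iff_isStarNormal_and_quasispectrumRestricts]
    refine ⟨hn, ?_⟩
    change SpectrumRestricts z Complex.reCLM
    rw [SpectrumRestricts.real_iff]
    intro l hl
    exact (Complex.eq_re_of_ofReal_le (r := 0) (by simpa using hspec l hl))
  rw [nonneg_iff_isSelfAdjoint_and_quasispectrumRestricts]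
  refine ⟨hsa, ?_⟩
  change SpectrumRestricts z ContinuousMap.realToNNReal
  rw [SpectrumRestricts.nnreal_iff]
  intro r hr
  have := hspec _ (spectrum.algebraMap_mem ℂ hr)
  simpa using this

end SpatialTensor

/-! ### Conjugation by `d^{-1/2}`. -/

open SpatialTensor

/-- If `-d ≤ t ≤ d` with `d` positive and invertible, then `d^{-1/2} t d^{-1/2}` is a
contraction. -/
theorem norm_conjugate_rpow_neg_one_half_le_one {E : Type*} [CStarAlgebra E] [PartialOrder E]
    [StarOrderedRing E] {d t : E} (hd : IsStrictlyPositive d) (h1 : -d ≤ t) (h2 : t ≤ d) :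
    ‖d ^ (-(1 / 2) : ℝ) * t * d ^ (-(1 / 2) : ℝ)‖ ≤ 1 := by
  have hr : IsSelfAdjoint (d ^ (-(1 / 2) : ℝ)) := IsSelfAdjoint.of_nonneg CFC.rpow_nonneg
  have k1 := hr.conjugate_le_conjugate h1
  have k2 := hr.conjugate_le_conjugate h2
  rw [mul_neg, neg_mul] at k1
  -- Since `d^{-1/2} d d^{-1/2} = 1`, the bounds become `-1 ≤ y ≤ 1`.
  rw [CFC.conjugate_rpow_neg_one_half d hd] at k1 k2
  set y := d ^ (-(1 / 2) : ℝ) * t * d ^ (-(1 / 2) : ℝ)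
  -- Self-adjointness comes from the order bound: `1 - y` is positive, so `y = 1 - (1 - y)` is
  -- self-adjoint.
  have hy : IsSelfAdjoint y := by
    have := IsSelfAdjoint.of_nonneg (sub_nonneg.2 k2)
    have h := (IsSelfAdjoint.one E).sub this
    rwa [sub_sub_cancel] at h
  rcases subsingleton_or_nontrivial E with hs | hn
  · rw [Subsingleton.elim y 0, norm_zero]
    exact zero_le_one
  have k1' : algebraMap ℝ E (-1) ≤ y := by simpa using k1
  have k2' : y ≤ algebraMap ℝ E 1 := by simpa using k2
  rw [algebraMap_le_iff_le_spectrum (a := y) hy] at k1'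
  rw [le_algebraMap_iff_spectrum_le (a := y) hy] at k2'
  -- One of `±‖y‖` is a spectral value, and the spectrum lies in `[-1, 1]`.
  rcases CStarAlgebra.norm_or_neg_norm_mem_spectrum hy with h | h
  · exact k2' _ h
  · linarith [k1' _ h]

/-! ### The numerical distance between states and the Lipschitz bound. -/

section Mof

variable {X : Type u} {A : X → Type v} [∀ x, CStarAlgebra (A x)] {D : BiField A}

open scoped ComplexOrder

theorem IsMof.prodState_symm (hD : IsMof D) {x x' : X} (φ : CState (A x)) (ψ : CState (A x')) :
    prodState ψ φ (D x' x) = prodState φ ψ (D x x') := by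
  rw [hD.symm x x', prodState_flip]

/-- The threefold product state is positive, so it preserves the operator inequality; the unit
identities evaluate its three terms. -/
theorem IsMof.prodState_triangle (hD : IsMof D) {x x' x'' : X} (φ : CState (A x))
    (ψ : CState (A x')) (ω : CState (A x'')) :
    prodState φ ω (D x x'') ≤ prodState φ ψ (D x x') + prodState ψ ω (D x' x'') := by
  have h := (prodCState (prodCState φ ψ) ω).functional_nonneg
    (sub_nonneg.2 (hD.triangle x x' x''))
  rw [map_sub, map_add, sub_nonneg] at h
  have h1 := prodState_midUnit φ ψ ω (D x x'')
  have h2 := prodState_rightUnit φ ψ ω (D x x')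
  have h3 := prodState_leftUnit φ ψ ω (D x' x'')
  rw [← h1, ← h2, ← h3]
  exact h

theorem IsCentral.inl_stateField_mem (hcentral : IsCentral D) (x₀ : X) (μ : CState (A x₀))
    (x x' : X) : inl (stateField D x₀ μ x) ∈ centerSubmodule (A x) (A x') :=
  tmul_mem_centerSubmodule (slice_mem_center μ (hcentral x₀ x)) Set.one_mem_center

theorem IsCentral.inr_stateField_mem (hcentral : IsCentral D) (x₀ : X) (μ : CState (A x₀))
    (x x' : X) : inr (stateField D x₀ μ x') ∈ centerSubmodule (A x) (A x') :=
  tmul_mem_centerSubmodule Set.one_mem_center (slice_mem_center μ (hcentral x₀ x'))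

/-- The fields `x ↦ (μ ⊗ id) D(x₀, x)` of a central mof have Lipschitz constant at most `1`. -/
theorem lipSeminorm_stateField_le (hD : IsMof D) (hcentral : IsCentral D) (x₀ : X)
    (μ : CState (A x₀)) : lipSeminorm D (stateField D x₀ μ) ≤ 1 := by
  refine iSup_le fun x => iSup_le fun x' => iSup_le fun hx => ?_
  have hl := hcentral.inl_stateField_mem x₀ μ x x'
  have hr := hcentral.inr_stateField_mem x₀ μ x x'
  -- `centerSubmodule` has `centerTensor` as its underlying set by definition; the submodule form
  -- allows sums and differences.
  have hDm : D x x' ∈ centerSubmodule (A x) (A x') := hcentral x x'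
  have hpos : IsStrictlyPositive (D x x') :=
    IsStrictlyPositive.iff_of_unital.2 (hD.pos x x' hx)
  -- At `φ ⊗ ψ` this reads `d(μ, ψ) ≤ d(μ, φ) + d(φ, ψ)`.
  have h1 : 0 ≤ D x x' + (inl (stateField D x₀ μ x) - inr (stateField D x₀ μ x')) := by
    refine nonneg_of_prodState_nonneg (add_mem hDm (sub_mem hl hr)) fun φ ψ => ?_
    rw [map_add, map_sub, prodState_inl, prodState_inr, add_sub_left_comm, ← add_sub_assoc,
      sub_nonneg]
    exact hD.prodState_triangle μ φ ψ
  -- At `φ ⊗ ψ` this reads `d(μ, φ) ≤ d(μ, ψ) + d(ψ, φ)`, after using the symmetry of `d`.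
  have h2 : 0 ≤ D x x' - (inl (stateField D x₀ μ x) - inr (stateField D x₀ μ x')) := by
    refine nonneg_of_prodState_nonneg (sub_mem hDm (sub_mem hl hr)) fun φ ψ => ?_
    rw [map_sub, map_sub, prodState_inl, prodState_inr, sub_sub_eq_add_sub, sub_nonneg,
      ← hD.prodState_symm φ ψ, add_comm]
    exact hD.prodState_triangle μ ψ φ
  have := norm_conjugate_rpow_neg_one_half_le_one hpos (neg_le_iff_add_nonneg'.2 h1)
    (sub_nonneg.1 h2)
  rw [← ofReal_norm]
  exact ENNReal.ofReal_le_one.2 this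

theorem isLipschitzField_stateField (hD : IsMof D) (hcentral : IsCentral D) (x₀ : X)
    (μ : CState (A x₀)) : IsLipschitzField D (stateField D x₀ μ) :=
  (lipSeminorm_stateField_le hD hcentral x₀ μ).trans_lt ENNReal.one_lt_top

/-! ### Scalar fields force a scalar valued mof. -/

theorem prodState_smul_one {B C : Type v} [CStarAlgebra B] [CStarAlgebra C] (φ : CState B)
    (ψ : CState C) (c : ℂ) : prodState φ ψ (c • (1 : SpatialTensor B C)) = c := by
  rw [map_smul, prodState_one, smul_eq_mul, mul_one]

/-- An element of `Z(B) ⊗ Z(C)` on which all product states agree is a scalar. -/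
theorem eq_smul_one_of_prodState_eq {B C : Type v} [CStarAlgebra B] [CStarAlgebra C]
    {z : SpatialTensor B C} (hz : z ∈ centerTensor B C) {c : ℂ}
    (h : ∀ (φ : CState B) (ψ : CState C), prodState φ ψ z = c) : z = c • 1 := by
  have hone : (1 : SpatialTensor B C) ∈ centerSubmodule B C :=
    tmul_mem_centerSubmodule Set.one_mem_center Set.one_mem_center
  have hz' : z ∈ centerSubmodule B C := hz
  have hc := (centerSubmodule B C).smul_mem c hone
  -- Both `c • 1 - z` and `z - c • 1` vanish at every product state, hence both are positive.
  refine le_antisymm (sub_nonneg.1 ?_) (sub_nonneg.1 ?_)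
  · refine nonneg_of_prodState_nonneg (sub_mem hc hz') fun φ ψ => ?_
    rw [map_sub, prodState_smul_one, h, sub_self]
  · refine nonneg_of_prodState_nonneg (sub_mem hz' hc) fun φ ψ => ?_
    rw [map_sub, prodState_smul_one, h, sub_self]

/-- A mof with scalar values is scalar valued. -/
theorem IsMof.isScalarMof (hD : IsMof D) {c : X → X → ℂ}
    (hc : ∀ x x', D x x' = c x x' • (1 : SpatialTensor (A x) (A x'))) : IsScalarMof D := by
  obtain ⟨μ, hμ⟩ := hD.metricStates
  -- Metric states read off the scalars: on the diagonal they give `0`, elsewhere the metric axioms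
  -- pass from `D` to `c`.
  have hval : ∀ x x', prodState (μ x) (μ x') (D x x') = c x x' := fun x x' => by
    rw [hc, prodState_smul_one]
  have hself : ∀ x, c x x = 0 := fun x => by rw [← hval, hμ]
  have hnonneg : ∀ x x', 0 ≤ c x x' := by
    intro x x'
    rcases eq_or_ne x x' with rfl | hx
    · rw [hself]
    · rw [← hval]
      exact (prodCState (μ x) (μ x')).functional_nonneg (hD.pos x x' hx).1
  have hre : ∀ x x', (((c x x').re : ℝ) : ℂ) = c x x' := fun x x' =>
    (Complex.eq_re_of_ofReal_le (r := 0) (by simpa using hnonneg x x')).symm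
  have hsymm : ∀ x x', c x x' = c x' x := fun x x' => by
    rw [← hval, ← hval, hD.prodState_symm]
  let d : MetricSpace X :=
    { dist := fun x x' => (c x x').re
      dist_self := fun x => by rw [hself, Complex.zero_re]
      dist_comm := fun x x' => by rw [hsymm]
      dist_triangle := fun x x' x'' => by
        have := hD.prodState_triangle (μ x) (μ x') (μ x'')
        rw [hval, hval, hval] at this
        exact (Complex.le_def.1 this).1
      eq_of_dist_eq_zero := fun {x x'} h => by
        by_contra hx
        -- An invertible zero would mean `0 = 1` in `A x ⊗ A x'`, but a product state has value `1`
        -- at the unit.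
        have h0 : D x x' = 0 := by rw [hc, ← hre, h, Complex.ofReal_zero, zero_smul]
        have hu := (hD.pos x x' hx).2
        rw [h0, isUnit_zero_iff] at hu
        have := prodState_one (μ x) (μ x')
        rw [← hu, map_zero] at this
        exact zero_ne_one this }
  exact ⟨d, fun x x' => (hc x x').trans (congrArg (· • _) (hre x x').symm)⟩

/-- A central mof all of whose fields `x ↦ (μ ⊗ id) D(x₀, x)` are scalar is scalar valued. -/
theorem isScalarMof_of_isScalarField (hD : IsMof D) (hcentral : IsCentral D)
    (h : ∀ (x₀ : X) (μ : CState (A x₀)), IsScalarField (stateField D x₀ μ)) : IsScalarMof D := by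
  -- These serve as reference states: the candidate scalar for `D x x'` is its value at `μ x ⊗ μ
  -- x'`.
  obtain ⟨μ, -⟩ := hD.metricStates
  have hright : ∀ {x x' : X} (φ : CState (A x)) (ψ ψ' : CState (A x')),
      prodState φ ψ (D x x') = prodState φ ψ' (D x x') := by
    intro x x' φ ψ ψ'
    obtain ⟨c, hc⟩ := h x φ
    have hs : slice φ (D x x') = c x' • (1 : A x') := congrFun hc x'
    rw [prodState, prodState, ContinuousLinearMap.comp_apply, ContinuousLinearMap.comp_apply, hs,
      map_smul, map_smul, ψ.apply_one, ψ'.apply_one]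
  refine hD.isScalarMof (c := fun x x' => prodState (μ x) (μ x') (D x x')) fun x x' =>
    eq_smul_one_of_prodState_eq (hcentral x x') fun φ ψ => ?_
  -- Replace the second state by the reference state, flip, replace the other one, and flip back.
  rw [hright φ ψ (μ x'), ← hD.prodState_symm, hright (μ x') φ (μ x), hD.prodState_symm]

/-- Slices are contractive, so the field inherits the bound of `D`; commutation is automatic because
`D x x'` is central in `A x ⊗ A x'`. -/
theorem stateField_mem_lipAlgebra (hD : IsMof D) (hcentral : IsCentral D)
    (hbdd : IsBoundedBiField D) (x₀ : X) (μ : CState (A x₀)) :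
    stateField D x₀ μ ∈ LipAlgebra D := by
  obtain ⟨c, hc⟩ := hbdd
  exact ⟨⟨c, fun x => (norm_slice_le μ _).trans (hc x₀ x)⟩,
    isLipschitzField_stateField hD hcentral x₀ μ,
    fun x x' => (Semigroup.mem_center_iff.1
      (centerTensor_subset_center (hcentral x x')) (inl (stateField D x₀ μ x))).symm⟩

end Mof
end

theorem mainTheorem7 {X : Type u} (A : X → Type v) [∀ x, CStarAlgebra (A x)]
    (D : BiField A) (hD : IsMof D) (hcentral : IsCentral D) (hscalar : ¬ IsScalarMof D) :
    (∃ f : ∀ x, A x, IsLipschitzField D f ∧ ¬ IsScalarField f) ∧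
    (∃ (x₀ : X) (μ : CState (A x₀)),
      IsLipschitzField D (stateField D x₀ μ) ∧ ¬ IsScalarField (stateField D x₀ μ)) ∧
    (IsBoundedBiField D →
      ¬ Set.SurjOn (scalarField A) (LipFunctions (normMetric D)) (LipAlgebra D)) := by
  obtain ⟨x₀, μ, hμ⟩ : ∃ (x₀ : X) (μ : CState (A x₀)), ¬ IsScalarField (stateField D x₀ μ) := by
    by_contra! h
    exact hscalar (isScalarMof_of_isScalarField hD hcentral h)
  have hlip := isLipschitzField_stateField hD hcentral x₀ μ
  refine ⟨⟨_, hlip, hμ⟩, ⟨x₀, μ, hlip, hμ⟩, fun hbdd hsurj => hμ ?_⟩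
  -- The nonscalar field lies in `Lip(D)`, and any preimage of it would exhibit it as scalar valued.
  obtain ⟨f, -, hf⟩ := hsurj (stateField_mem_lipAlgebra hD hcentral hbdd x₀ μ)
  exact ⟨f, hf.symm⟩
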